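/- Let $f:\mathbb{R}^n\to[0,\infty]$, $g:\mathbb{R}^m\times\mathbb{R}^l\to[0,\infty]$, let $A:\mathbb{R}^n\to\mathbb{R}^m$ be linear and $\mathcal{Z}\subseteq\mathbb{R}^l$ a closed (possibly nonconvex) set. Write $\mathrm{dom}$ for the set where a function is finite, and for $r,M\ge 0$ let $$\mathcal{S}_\mathcal{Z}(r,M)=\{(y,z):\ g(y,z)\le M,\ \|(y,z)\|\le r,\ z\in\mathcal{Z}\}.$$ Assume: 1. $f$ is continuous as a map into $[0,\infty]$ and differentiable on $\mathrm{dom}(f)$; $g$ is continuous as a map into $[0,\infty]$ and twice continuously differentiable on $\mathrm{dom}(g)$. 2. $(x,z)\mapsto f(x)+g(Ax,z)$ is coercive on $\mathbb{R}^n\times\mathbb{R}^l$, i.e. it tends to $\infty$ as $\|(x,z)\|\to\infty$. 3. A point $x^0\in\mathbb{R}^n$ is given for which some $\tilde z\in\mathcal{Z}$ satisfies $f(x^0)+g(Ax^0,\tilde z)<\infty$. 4. $g(\cdot,z)$ is convex for every $z$. 5. Whenever $(y,z)\in\mathcal{S}_\mathcal{Z}(r,M)$, the function $g(y,\cdot)$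 has a unique global minimizer over $\mathcal{Z}$, denoted $z(y)$; for all $r,M$ there is $\bar r$ such that $(y,z)\in\mathcal{S}_\mathcal{Z}(r,M)$ implies $(y,z(y))\in\mathcal{S}_\mathcal{Z}(\bar r,M)$; and for all $r,M$ the map $z(\cdot)$ is Lipschitz continuous on $\{y:(y,z(y))\in\mathcal{S}_\mathcal{Z}(r,M)\}$, with a constant that may depend on $r$ and $M$. For parameters $\beta_x,\beta_y,\beta>0$ let $\mathcal{L}(x,y,z,\lambda)=f(x)+g(y,z)+\frac{\beta}{2}\|Ax-y\|^2+\lambda^T(Ax-y)$. A sequence $(x^k,y^k,z^k,\lambda^k)_{k\ge0}$ is generated by BC-ADMM if it starts at the given $x^0$ with $y^0=Ax^0$, $z^0=z(y^0)$, $\lambda^0=\nabla_y g(y^0,z^0)$, and for every $k\ge 0$: - $x^{k+1}$ is a local minimizer of $x\mapsto\mathcal{L}(x,y^k,z^k,\lambda^k)+\frac{\beta_x}{2}\|x-x^k\|^2$ whose objective value is at most that of $x^k$ (for example a global minimizer); - $y^{k+1}$ is a global minimizer of $y\mapsto\mathcal{L}(x^{k+1},y,z^k,\lambda^k)+\frac{\beta_y}{2}\|y-y^k\|^2$;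 - $z^{k+1}$ is a global minimizer of $\mathcal{L}(x^{k+1},y^{k+1},\cdot,\lambda^k)$ over $\mathcal{Z}$; - $\lambda^{k+1}=\lambda^k+\beta(Ax^{k+1}-y^{k+1})$. For $\epsilon>0$ call $(x,z)$ an $\epsilon$-stationary solution of $\min_{x,\,z\in\mathcal{Z}}f(x)+g(Ax,z)$ if $z\in\mathcal{Z}$, $f(x)+g(Ax,z)<\infty$, $$\|\nabla f(x)+A^T\nabla_y g(Ax,z)\|\le\epsilon\quad\text{and}\quad\mathrm{dist}\big(N_\mathcal{Z}(z),-\nabla_z g(Ax,z)\big)\le\epsilon,$$ where $N_\mathcal{Z}(z)$ is the (limiting) normal cone of $\mathcal{Z}$ at $z$, that is, the set of limits $\lim_i u_i$ with $z_i\in\mathcal{Z}$, $z_i\to z$ and $\langle u_i,w-z_i\rangle\le o(\|w-z_i\|)$ as $w\to z_i$ in $\mathcal{Z}$. Then, for all sufficiently large $\beta_x,\beta_y,\beta$ (the threshold for $\beta$ may depend on $\beta_y$; the thresholds for $\beta_x$ and $\beta_y$ depend only on the problem data), every iterate of every sequence generated by BC-ADMM satisfies $f(x^k)+g(Ax^k,z^k)<\infty$,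 and BC-ADMM reaches an $\epsilon$-stationary solution with oracle complexity $O(\epsilon^{-2})$: there is a constant $C$, depending on the problem data and on $\beta_x,\beta_y,\beta$ but neither on $\epsilon$ nor on the sequence generated, such that for every $\epsilon\in(0,1]$ some $k\le C\epsilon^{-2}$ makes $(x^k,z^k)$ an $\epsilon$-stationary solution. -/

import Mathlib

open scoped NNReal ENNReal Topology
open Filter

noncomputable section

namespace BCADMM

/-- Euclidean space of dimension `d` with its `ℓ²` norm. -/
abbrev Eu (d : ℕ) : Type := EuclideanSpace ℝ (Fin d)

variable {n m l : ℕ}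

/-- The effective domain of an extended nonnegative function. -/
def dom {X : Type*} (h : X → ℝ≥0∞) : Set X := {p | h p < ∞}

/-- `S_𝒵(r, M)`: the pairs `(y, z)` with `g(y, z) ≤ M`, Euclidean norm at most `r`, and `z ∈ 𝒵`. -/
def sublevel (g : Eu m → Eu l → ℝ≥0∞) (Z : Set (Eu l)) (r : ℝ) (M : ℝ≥0) : Set (Eu m × Eu l) :=
  {p | g p.1 p.2 ≤ (M : ℝ≥0∞) ∧ √(‖p.1‖ ^ 2 + ‖p.2‖ ^ 2) ≤ r ∧ p.2 ∈ Z}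

/-- The standing assumptions on the problem `min f(x) + g(Ax, z)` over `x` and `z ∈ Z`.
`x₀, zf` is the given strictly feasible point, and `zsol` is the function `y ↦ z(y)`; its values
matter only at those `y` for which `g(y, ·)` is finite somewhere on `Z`. Continuity of `f` and `g`
is continuity as maps into `[0, ∞]`. -/
structure Assumptions (f : Eu n → ℝ≥0∞) (g : Eu m → Eu l → ℝ≥0∞) (A : Eu n →L[ℝ] Eu m)
    (Z : Set (Eu l)) (x₀ : Eu n) (zf : Eu l) (zsol : Eu m → Eu l) : Prop where
  f_cont : Continuous f
  f_diff : DifferentiableOn ℝ (fun x => (f x).toReal) (dom f)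
  g_cont : Continuous (fun p : Eu m × Eu l => g p.1 p.2)
  g_smooth : ContDiffOn ℝ 2 (fun p : Eu m × Eu l => (g p.1 p.2).toReal)
    (dom (fun p : Eu m × Eu l => g p.1 p.2))
  coercive : Tendsto (fun p : Eu n × Eu l => f p.1 + g (A p.1) p.2) (cocompact _) (𝓝 ∞)
  zf_mem : zf ∈ Z
  feasible : f x₀ + g (A x₀) zf < ∞
  g_convex : ∀ z, ConvexOn ℝ≥0 Set.univ (fun y => g y z)
  Z_closed : IsClosed Z
  /-- Wherever `(y, z) ∈ S_𝒵(r, M)`, `zsol y` is the unique minimizer of `g(y, ·)` over `Z`. -/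
  minimizer : ∀ (r : ℝ) (M : ℝ≥0), ∀ y z, (y, z) ∈ sublevel g Z r M →
    zsol y ∈ Z ∧ ∀ z' ∈ Z, z' ≠ zsol y → g y (zsol y) < g y z'
  minimizer_bound : ∀ (r : ℝ) (M : ℝ≥0), ∃ r' : ℝ, ∀ y z, (y, z) ∈ sublevel g Z r M →
    (y, zsol y) ∈ sublevel g Z r' M
  minimizer_lipschitz : ∀ (r : ℝ) (M : ℝ≥0), ∃ L : ℝ≥0,
    LipschitzOnWith L zsol {y | (y, zsol y) ∈ sublevel g Z r M}

/-- The augmented Lagrangian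
`f(x) + g(y, z) + (β/2) ‖Ax - y‖² + λᵀ(Ax - y)`. -/
def lagrangian (f : Eu n → ℝ≥0∞) (g : Eu m → Eu l → ℝ≥0∞) (A : Eu n →L[ℝ] Eu m) (β : ℝ)
    (x : Eu n) (y : Eu m) (z : Eu l) (lam : Eu m) : EReal :=
  (f x : EReal) + (g y z : EReal)
    + ((β / 2 * ‖A x - y‖ ^ 2 + inner ℝ lam (A x - y) : ℝ) : EReal)

/-- The objective of the `x`-subproblem with previous iterate `xk`. -/
def xObjective (f : Eu n → ℝ≥0∞) (g : Eu m → Eu l → ℝ≥0∞) (A : Eu n →L[ℝ] Eu m) (βx β : ℝ)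
    (xk : Eu n) (y : Eu m) (z : Eu l) (lam : Eu m) (x : Eu n) : EReal :=
  lagrangian f g A β x y z lam + ((βx / 2 * ‖x - xk‖ ^ 2 : ℝ) : EReal)

/-- The objective of the `y`-subproblem with previous iterate `yk`. -/
def yObjective (f : Eu n → ℝ≥0∞) (g : Eu m → Eu l → ℝ≥0∞) (A : Eu n →L[ℝ] Eu m) (βy β : ℝ)
    (x : Eu n) (yk : Eu m) (z : Eu l) (lam : Eu m) (y : Eu m) : EReal :=
  lagrangian f g A β x y z lam + ((βy / 2 * ‖y - yk‖ ^ 2 : ℝ) : EReal)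

/-- The partial gradient `∇_y g(y, z)`. -/
def gradY (g : Eu m → Eu l → ℝ≥0∞) (y : Eu m) (z : Eu l) : Eu m :=
  gradient (fun y' => (g y' z).toReal) y

/-- The partial gradient `∇_z g(y, z)`. -/
def gradZ (g : Eu m → Eu l → ℝ≥0∞) (y : Eu m) (z : Eu l) : Eu l :=
  gradient (fun z' => (g y z').toReal) z

/-- `(x, y, z, lam)` is a sequence of iterates generated by BC-ADMM from `x₀`. The `x`-subproblem
is solved to local optimality, with an objective value no larger than that of the initial guess
`x k`; the `y`- and `z`-subproblems are solved globally. -/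
structure IsRun (f : Eu n → ℝ≥0∞) (g : Eu m → Eu l → ℝ≥0∞) (A : Eu n →L[ℝ] Eu m)
    (Z : Set (Eu l)) (x₀ : Eu n) (zsol : Eu m → Eu l) (βx βy β : ℝ)
    (x : ℕ → Eu n) (y : ℕ → Eu m) (z : ℕ → Eu l) (lam : ℕ → Eu m) : Prop where
  x_zero : x 0 = x₀
  y_zero : y 0 = A x₀
  z_zero : z 0 = zsol (y 0)
  lam_zero : lam 0 = gradY g (y 0) (z 0)
  x_local : ∀ k, IsLocalMin (xObjective f g A βx β (x k) (y k) (z k) (lam k)) (x (k + 1))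
  x_descent : ∀ k, xObjective f g A βx β (x k) (y k) (z k) (lam k) (x (k + 1)) ≤
    xObjective f g A βx β (x k) (y k) (z k) (lam k) (x k)
  y_min : ∀ k, IsMinOn (yObjective f g A βy β (x (k + 1)) (y k) (z k) (lam k)) Set.univ
    (y (k + 1))
  z_mem : ∀ k, z (k + 1) ∈ Z
  z_min : ∀ k, IsMinOn (fun w => lagrangian f g A β (x (k + 1)) (y (k + 1)) w (lam k)) Z
    (z (k + 1))
  lam_succ : ∀ k, lam (k + 1) = lam k + β • (A (x (k + 1)) - y (k + 1))

/-- The cone of regular normals to `C` at `z`: the `v` with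
`⟨v, w - z⟩ ≤ o(‖w - z‖)` for `w ∈ C`, `w → z`. -/
def regularNormalCone (C : Set (Eu l)) (z : Eu l) : Set (Eu l) :=
  {v | z ∈ C ∧ ∀ ε > 0, ∀ᶠ w in 𝓝[C] z, inner ℝ v (w - z) ≤ ε * ‖w - z‖}

/-- The (limiting) normal cone `N_C(z)` of variational analysis: limits of regular normals at
points of `C` converging to `z`. -/
def normalCone (C : Set (Eu l)) (z : Eu l) : Set (Eu l) :=
  {v | z ∈ C ∧ ∃ (w : ℕ → Eu l) (u : ℕ → Eu l), (∀ i, u i ∈ regularNormalCone C (w i)) ∧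
    Tendsto w atTop (𝓝 z) ∧ Tendsto u atTop (𝓝 v)}

/-- `(x, z)` is an `ε`-stationary solution of `min f(x) + g(Ax, z)` over `x` and `z ∈ Z`. -/
structure IsEpsStationary (f : Eu n → ℝ≥0∞) (g : Eu m → Eu l → ℝ≥0∞) (A : Eu n →L[ℝ] Eu m)
    (Z : Set (Eu l)) (ε : ℝ) (x : Eu n) (z : Eu l) : Prop where
  mem : z ∈ Z
  finite : f x + g (A x) z < ∞
  grad_x : ‖gradient (fun x' => (f x').toReal) x
    + ContinuousLinearMap.adjoint A (gradY g (A x) z)‖ ≤ ε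
  grad_z : Metric.infDist (-gradZ g (A x) z) (normalCone Z z) ≤ ε

end BCADMM

end

open scoped NNReal ENNReal Topology
open Filter

noncomputable section

namespace BCADMM

variable {n m l : ℕ}

/-! ### First-order optimality, normal cones and elementary inequalities. -/

section Calculus

variable {E F : Type*} [NormedAddCommGroup E] [InnerProductSpace ℝ E]
  [NormedAddCommGroup F] [InnerProductSpace ℝ F]

/-! The engine is the descent of the Lyapunov function `potential`: the augmented Lagrangian plus
`βy / 4 * ‖y k - y (k - 1)‖ ^ 2`. The `x`-, `y`- and `z`-updates do not increase the Lagrangian, and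
the first two gain proximal terms; only the multiplier update can raise it, by `‖lam (k + 1) - lam
k‖ ^ 2 / β`. Optimality in `y` gives `lam (k + 1) = ∇_y g (y (k + 1), z k) + βy • (y (k + 1) - y
k)`, so multiplier steps are bounded by two consecutive `y`-steps and, for large `β`, their cost is
absorbed.

Lipschitz constants exist only on bounded sublevel sets, so boundedness must be propagated along
with descent, with constants chosen before the penalties (`Bounds`). The multiplier formula gives
`‖lam k‖ ^ 2 ≤ β`, so the Lagrangian bounds `f + g + (β / 4) ‖Ax - y‖ ^ 2 - 1` from above. Bounded
energy then makes `Ax - y` small, which transfers finiteness of `g` from `y` to `Ax`, and coercivity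
bounds `x` and `z`. `Invariant.succ` runs this induction.

`Bounds.isEpsStationary` bounds the stationarity residual by a multiple of the step lengths. Their
squares have a bounded sum, so among `N` iterations one has residual `O(N ^ (-1/2))`. -/

theorem isOpen_dom {X : Type*} [TopologicalSpace X] {h : X → ℝ≥0∞} (hc : Continuous h) :
    IsOpen (dom h) :=
  isOpen_Iio.preimage hc

theorem hasGradientAt_fst [CompleteSpace E] {G : E × F → ℝ} {G' : E × F →L[ℝ] ℝ} {y : E} {z : F}
    (hG : HasFDerivAt G G' (y, z)) :
    HasGradientAt (fun y' => G (y', z))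
      ((InnerProductSpace.toDual ℝ E).symm (G'.comp (ContinuousLinearMap.inl ℝ E F))) y := by
  rw [hasGradientAt_iff_hasFDerivAt, LinearIsometryEquiv.apply_symm_apply]
  exact hG.comp y (hasFDerivAt_prodMk_left y z)

theorem hasGradientAt_snd [CompleteSpace F] {G : E × F → ℝ} {G' : E × F →L[ℝ] ℝ} {y : E} {z : F}
    (hG : HasFDerivAt G G' (y, z)) :
    HasGradientAt (fun z' => G (y, z'))
      ((InnerProductSpace.toDual ℝ F).symm (G'.comp (ContinuousLinearMap.inr ℝ E F))) z := by
  rw [hasGradientAt_iff_hasFDerivAt, LinearIsometryEquiv.apply_symm_apply]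
  exact hG.comp z (hasFDerivAt_prodMk_right y z)

/-- `K` need not be convex, so the mean value inequality along segments is not available; local
Lipschitz continuity on a compact set suffices. -/
theorem exists_lipschitz_bound_of_contDiffAt {V W : Type*} [NormedAddCommGroup V]
    [NormedSpace ℝ V] [NormedAddCommGroup W] [NormedSpace ℝ W] {φ : V → W} {K : Set V}
    (hK : IsCompact K) (hφ : ∀ p ∈ K, ContDiffAt ℝ 1 φ p) :
    ∃ L : ℝ, 0 ≤ L ∧ (∀ p ∈ K, ‖φ p‖ ≤ L) ∧ ∀ p ∈ K, ∀ q ∈ K, ‖φ p - φ q‖ ≤ L * ‖p - q‖ := by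
  have hloc : LocallyLipschitzOn K φ := fun p hp => by
    obtain ⟨c, t, ht, hc⟩ := (hφ p hp).exists_lipschitzOnWith
    exact ⟨c, t, mem_nhdsWithin_of_mem_nhds ht, hc⟩
  obtain ⟨c, hc⟩ := hloc.exists_lipschitzOnWith_of_compact hK
  obtain ⟨d, hd⟩ := hK.exists_bound_of_continuousOn hc.continuousOn
  refine ⟨max c d, le_max_of_le_left c.2, fun p hp => (hd p hp).trans (le_max_right _ _), ?_⟩
  intro p hp q hq
  refine (hc.norm_sub_le hp hq).trans ?_
  gcongr
  exact le_max_left _ _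

/-- First-order optimality for a differentiable function plus the quadratic and linear terms of
an augmented Lagrangian and a proximal term. -/
theorem gradient_eq_zero_of_isLocalMin_augmented [CompleteSpace E] [CompleteSpace F]
    {φ : E → ℝ} {v : E} {u u₀ : E} {B : E →L[ℝ] F}
    {w lam : F} {β γ : ℝ} (hφ : HasGradientAt φ v u)
    (hmin : IsLocalMin (fun t => φ t + (β / 2 * ‖B t - w‖ ^ 2 + inner ℝ lam (B t - w))
      + γ / 2 * ‖t - u₀‖ ^ 2) u) :
    v + ContinuousLinearMap.adjoint B (lam + β • (B u - w)) + γ • (u - u₀) = 0 := by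
  have h1 : HasFDerivAt (fun t => B t - w) B u := B.hasFDerivAt.sub_const w
  have h2 : HasFDerivAt (fun t => t - u₀) (ContinuousLinearMap.id ℝ E) u :=
    (hasFDerivAt_id u).sub_const u₀
  have h3 := ((hφ.hasFDerivAt.add (((h1.norm_sq).const_mul (β / 2)).add
    ((hasFDerivAt_const lam u).inner ℝ h1))).add ((h2.norm_sq).const_mul (γ / 2)))
  have h4 := hmin.hasFDerivAt_eq_zero h3
  refine ext_inner_right ℝ fun d => ?_
  have h5 := congrArg (fun T : E →L[ℝ] ℝ => T d) h4
  simp only [add_apply, smul_apply,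
    ContinuousLinearMap.comp_apply, ContinuousLinearMap.prod_apply, fderivInnerCLM_apply,
    innerSL_apply_apply, zero_apply, InnerProductSpace.toDual_apply_apply,
    ContinuousLinearMap.id_apply, smul_eq_mul, inner_zero_left, nsmul_eq_mul] at h5
  rw [inner_zero_left, inner_add_left, inner_add_left, ContinuousLinearMap.adjoint_inner_left,
    inner_add_left, inner_smul_left, inner_smul_left]
  simp only [conj_trivial]
  rw [← h5]
  push_cast
  ring

theorem neg_gradient_mem_regularNormalCone {φ : Eu l → ℝ} {v z : Eu l} {C : Set (Eu l)}
    (hz : z ∈ C) (hφ : HasGradientAt φ v z) (hmin : ∀ᶠ w in 𝓝[C] z, φ z ≤ φ w) :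
    -v ∈ regularNormalCone C z := by
  refine ⟨hz, fun ε hε => ?_⟩
  have h := (hasGradientAt_iff_isLittleO.1 hφ).def hε
  filter_upwards [hmin, mem_nhdsWithin_of_mem_nhds h] with w hw hw'
  have := (abs_le.1 hw').2
  rw [inner_neg_left]
  linarith

theorem regularNormalCone_subset_normalCone (C : Set (Eu l)) (z : Eu l) :
    regularNormalCone C z ⊆ normalCone C z := fun v hv =>
  ⟨hv.1, fun _ => z, fun _ => v, fun _ => hv, tendsto_const_nhds, tendsto_const_nhds⟩

/-- Young's inequality: `√β ‖r‖ ≤ 1 + (β / 4) ‖r‖ ^ 2`. The loss is the absolute constant 1,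
whatever `β` is. -/
theorem half_sq_add_inner_ge {lam r : F} {β : ℝ} (hβ : 0 < β) (hlam : ‖lam‖ ^ 2 ≤ β) :
    β / 4 * ‖r‖ ^ 2 - 1 ≤ β / 2 * ‖r‖ ^ 2 + inner ℝ lam r := by
  have h1 := (abs_le.1 (abs_real_inner_le_norm lam r)).1
  have h2 : ‖lam‖ * ‖r‖ ≤ 1 + β / 4 * ‖r‖ ^ 2 := by
    have h3 : ‖lam‖ ≤ √β := Real.le_sqrt_of_sq_le hlam
    have h4 : ‖lam‖ * ‖r‖ ≤ √β * ‖r‖ := by gcongr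
    have h5 : √β ^ 2 = β := Real.sq_sqrt hβ.le
    nlinarith [sq_nonneg (√β * ‖r‖ / 2 - 1)]
  linarith

end Calculus

/-! ### Passing from extended-real inequalities to real ones. -/

section Extended

theorem coe_add_eq_coe_real {a b : ℝ≥0∞} (ha : a < ∞) (hb : b < ∞) (c : ℝ) :
    (a : EReal) + (b : EReal) + (c : EReal) = ((a.toReal + b.toReal + c : ℝ) : EReal) := by
  lift a to ℝ≥0 using ha.ne
  lift b to ℝ≥0 using hb.ne
  push_cast
  rfl

theorem finite_and_real_le_of_coe_add_le {a b : ℝ≥0∞} {c d : ℝ}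
    (h : (a : EReal) + (b : EReal) + (c : EReal) ≤ (d : EReal)) :
    a < ∞ ∧ b < ∞ ∧ a.toReal + b.toReal + c ≤ d := by
  have ha : a < ∞ := by
    refine lt_top_iff_ne_top.2 fun ha => ?_
    rw [ha, EReal.coe_ennreal_top, EReal.top_add_of_ne_bot (EReal.coe_ennreal_ne_bot b),
      EReal.top_add_coe] at h
    exact absurd h (by simp)
  have hb : b < ∞ := by
    refine lt_top_iff_ne_top.2 fun hb => ?_
    rw [hb, EReal.coe_ennreal_top, EReal.add_top_of_ne_bot (EReal.coe_ennreal_ne_bot a),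
      EReal.top_add_coe] at h
    exact absurd h (by simp)
  rw [coe_add_eq_coe_real ha hb] at h
  exact ⟨ha, hb, EReal.coe_le_coe_iff.1 h⟩

end Extended

/-! ### Compact sublevel sets of `g`. -/

/-- The pairs at which `g` is at most `M` and whose components have norm at most `r`. -/
def boundedSublevel (g : Eu m → Eu l → ℝ≥0∞) (r M : ℝ) : Set (Eu m × Eu l) :=
  {p | g p.1 p.2 ≤ ENNReal.ofReal M ∧ ‖p.1‖ ≤ r ∧ ‖p.2‖ ≤ r}

theorem boundedSublevel_mono {g : Eu m → Eu l → ℝ≥0∞} {r r' M M' : ℝ} (hr : r ≤ r')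
    (hM : M ≤ M') : boundedSublevel g r M ⊆ boundedSublevel g r' M' := fun _ hp =>
  ⟨hp.1.trans (ENNReal.ofReal_le_ofReal hM), hp.2.1.trans hr, hp.2.2.trans hr⟩

theorem isCompact_boundedSublevel {g : Eu m → Eu l → ℝ≥0∞}
    (hg : Continuous (fun p : Eu m × Eu l => g p.1 p.2)) (r M : ℝ) :
    IsCompact (boundedSublevel g r M) := by
  refine Metric.isCompact_of_isClosed_isBounded ?_ ?_
  · exact (isClosed_le hg continuous_const).inter ((isClosed_le continuous_fst.norm
      continuous_const).inter (isClosed_le continuous_snd.norm continuous_const))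
  · refine (Metric.isBounded_closedBall (x := (0 : Eu m × Eu l)) (r := r)).subset fun p hp => ?_
    rw [mem_closedBall_zero_iff]
    exact max_le hp.2.1 hp.2.2

theorem mem_boundedSublevel_iff_real {g : Eu m → Eu l → ℝ≥0∞} {r M : ℝ} (hM : 0 ≤ M)
    {p : Eu m × Eu l} : p ∈ boundedSublevel g r M ↔
      g p.1 p.2 < ∞ ∧ (g p.1 p.2).toReal ≤ M ∧ ‖p.1‖ ≤ r ∧ ‖p.2‖ ≤ r := by
  constructor
  · rintro ⟨h1, h2⟩
    have h3 := h1.trans_lt ENNReal.ofReal_lt_top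
    exact ⟨h3, ENNReal.toReal_le_of_le_ofReal hM h1, h2⟩
  · rintro ⟨h1, h2, h3⟩
    exact ⟨(ENNReal.le_ofReal_iff_toReal_le h1.ne hM).2 h2, h3⟩

theorem mem_boundedSublevel_of_mem_sublevel {g : Eu m → Eu l → ℝ≥0∞} {Z : Set (Eu l)} {r M : ℝ}
    (hM : 0 ≤ M) {p : Eu m × Eu l} (hp : p ∈ sublevel g Z r ⟨M, hM⟩) :
    p ∈ boundedSublevel g r M := by
  refine ⟨?_, ?_, ?_⟩
  · rw [ENNReal.ofReal_eq_coe_nnreal hM]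
    exact hp.1
  · refine le_trans ?_ hp.2.1
    exact Real.le_sqrt_of_sq_le (by nlinarith [sq_nonneg ‖p.2‖])
  · refine le_trans ?_ hp.2.1
    exact Real.le_sqrt_of_sq_le (by nlinarith [sq_nonneg ‖p.1‖])

theorem mem_sublevel_of_mem_boundedSublevel {g : Eu m → Eu l → ℝ≥0∞} {Z : Set (Eu l)} {r M : ℝ}
    (hM : 0 ≤ M) {p : Eu m × Eu l} (hp : p ∈ boundedSublevel g r M) (hZ : p.2 ∈ Z) :
    -- The Euclidean norm of the pair is at most `√2 * r`; the factor 2 avoids the root.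
    p ∈ sublevel g Z (2 * r) ⟨M, hM⟩ := by
  refine ⟨?_, ?_, hZ⟩
  · have := hp.1
    rw [ENNReal.ofReal_eq_coe_nnreal hM] at this
    exact this
  · have h1 := hp.2.1
    have h2 := hp.2.2
    have h3 := norm_nonneg p.1
    have h4 := norm_nonneg p.2
    exact Real.sqrt_le_iff.2 ⟨by linarith, by nlinarith⟩

/-! ### Smoothness, coercivity and uniform continuity of the data. -/

section Data

variable {f : Eu n → ℝ≥0∞} {g : Eu m → Eu l → ℝ≥0∞} {A : Eu n →L[ℝ] Eu m} {Z : Set (Eu l)}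
  {x₀ : Eu n} {zf : Eu l} {zsol : Eu m → Eu l}

theorem Assumptions.contDiffAt (h : Assumptions f g A Z x₀ zf zsol) {y : Eu m} {z : Eu l}
    (hp : g y z < ∞) :
    ContDiffAt ℝ 2 (fun p : Eu m × Eu l => (g p.1 p.2).toReal) (y, z) :=
  h.g_smooth.contDiffAt ((isOpen_dom h.g_cont).mem_nhds hp)

theorem Assumptions.hasGradientAt_f (h : Assumptions f g A Z x₀ zf zsol) {x : Eu n}
    (hx : f x < ∞) :
    HasGradientAt (fun x' => (f x').toReal) (gradient (fun x' => (f x').toReal) x) x :=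
  (h.f_diff.differentiableAt ((isOpen_dom h.f_cont).mem_nhds hx)).hasGradientAt

theorem Assumptions.hasGradientAt_y (h : Assumptions f g A Z x₀ zf zsol) {y : Eu m} {z : Eu l}
    (hp : g y z < ∞) : HasGradientAt (fun y' => (g y' z).toReal) (gradY g y z) y :=
  (hasGradientAt_fst (h.contDiffAt hp |>.differentiableAt (by norm_num)).hasFDerivAt
    ).differentiableAt.hasGradientAt

theorem Assumptions.hasGradientAt_z (h : Assumptions f g A Z x₀ zf zsol) {y : Eu m} {z : Eu l}
    (hp : g y z < ∞) : HasGradientAt (fun z' => (g y z').toReal) (gradZ g y z) z :=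
  (hasGradientAt_snd (h.contDiffAt hp |>.differentiableAt (by norm_num)).hasFDerivAt
    ).differentiableAt.hasGradientAt

theorem Assumptions.contDiffAt_gradY (h : Assumptions f g A Z x₀ zf zsol) {p : Eu m × Eu l}
    (hp : g p.1 p.2 < ∞) : ContDiffAt ℝ 1 (fun q : Eu m × Eu l => gradY g q.1 q.2) p := by
  have h1 : ContDiffAt ℝ 1 (fderiv ℝ (fun p : Eu m × Eu l => (g p.1 p.2).toReal)) p :=
    (h.contDiffAt hp).fderiv_right (by norm_num)
  have h2 : ContDiffAt ℝ 1 (fun q => (InnerProductSpace.toDual ℝ (Eu m)).symm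
      ((fderiv ℝ (fun p : Eu m × Eu l => (g p.1 p.2).toReal) q).comp
        (ContinuousLinearMap.inl ℝ (Eu m) (Eu l)))) p :=
    (InnerProductSpace.toDual ℝ (Eu m)).symm.contDiff.contDiffAt.comp p
      (h1.clm_comp contDiffAt_const)
  -- The Riesz formula for the partial gradient is available on the domain of `g`, which is open,
  -- hence near `p`.
  refine h2.congr_of_eventuallyEq ?_
  filter_upwards [(isOpen_dom h.g_cont).mem_nhds hp] with q hq
  exact (hasGradientAt_fst
    (h.contDiffAt hq |>.differentiableAt (by norm_num)).hasFDerivAt).gradient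

theorem Assumptions.contDiffAt_gradZ (h : Assumptions f g A Z x₀ zf zsol) {p : Eu m × Eu l}
    (hp : g p.1 p.2 < ∞) : ContDiffAt ℝ 1 (fun q : Eu m × Eu l => gradZ g q.1 q.2) p := by
  have h1 : ContDiffAt ℝ 1 (fderiv ℝ (fun p : Eu m × Eu l => (g p.1 p.2).toReal)) p :=
    (h.contDiffAt hp).fderiv_right (by norm_num)
  have h2 : ContDiffAt ℝ 1 (fun q => (InnerProductSpace.toDual ℝ (Eu l)).symm
      ((fderiv ℝ (fun p : Eu m × Eu l => (g p.1 p.2).toReal) q).comp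
        (ContinuousLinearMap.inr ℝ (Eu m) (Eu l)))) p :=
    (InnerProductSpace.toDual ℝ (Eu l)).symm.contDiff.contDiffAt.comp p
      (h1.clm_comp contDiffAt_const)
  refine h2.congr_of_eventuallyEq ?_
  filter_upwards [(isOpen_dom h.g_cont).mem_nhds hp] with q hq
  exact (hasGradientAt_snd
    (h.contDiffAt hq |>.differentiableAt (by norm_num)).hasFDerivAt).gradient

theorem Assumptions.exists_norm_le (h : Assumptions f g A Z x₀ zf zsol) (M : ℝ) :
    ∃ R : ℝ, 0 ≤ R ∧ ∀ x z, f x < ∞ → g (A x) z < ∞ →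
      (f x).toReal + (g (A x) z).toReal ≤ M → ‖x‖ ≤ R ∧ ‖z‖ ≤ R := by
  have h1 : ∀ᶠ p : Eu n × Eu l in cocompact _, ENNReal.ofReal M < f p.1 + g (A p.1) p.2 :=
    h.coercive.eventually (lt_mem_nhds ENNReal.ofReal_lt_top)
  obtain ⟨K, hK, hKM⟩ := mem_cocompact.1 h1
  obtain ⟨R, hR⟩ := hK.isBounded.exists_norm_le
  refine ⟨max R 0, le_max_right _ _, fun x z hx hz hM => ?_⟩
  have hmem : (x, z) ∈ K := by
    by_contra hn
    have h2 : ENNReal.ofReal M < f x + g (A x) z := hKM hn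
    rw [← ENNReal.toReal_add hx.ne hz.ne] at hM
    exact absurd h2 (not_lt.2 (ENNReal.le_ofReal_iff_toReal_le
      (ENNReal.add_lt_top.2 ⟨hx, hz⟩).ne (ENNReal.toReal_nonneg.trans hM) |>.2 hM))
  have h3 := (hR _ hmem).trans (le_max_left R 0)
  exact ⟨(norm_fst_le (x, z)).trans h3, (norm_snd_le (x, z)).trans h3⟩

/-- Truncating `g` at `M + 1` gives a continuous real function, uniformly continuous on a ball. A
change of less than 1 from a value at most `M` stays below the truncation level, so `g` itself is
finite there. This is uniform although `g` may take the value `∞`. -/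
theorem exists_near_le_add_one {g : Eu m → Eu l → ℝ≥0∞}
    (hg : Continuous (fun p : Eu m × Eu l => g p.1 p.2)) (r : ℝ) {M : ℝ} (hM : 0 ≤ M) :
    ∃ δ : ℝ, 0 < δ ∧ δ ≤ 1 ∧ ∀ y z, (y, z) ∈ boundedSublevel g r M → ∀ y', ‖y' - y‖ ≤ δ →
      g y' z < ∞ ∧ (g y' z).toReal ≤ (g y z).toReal + 1 := by
  set c : Eu m × Eu l → ℝ := fun p => (min (g p.1 p.2) (ENNReal.ofReal (M + 1))).toReal with hc
  have hcc : Continuous c := by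
    refine ENNReal.continuousOn_toReal.comp_continuous (hg.min continuous_const) fun p => ?_
    exact ((min_le_right _ _).trans_lt ENNReal.ofReal_lt_top).ne
  have huc := (isCompact_closedBall (0 : Eu m × Eu l) (r + 1)).uniformContinuousOn_of_continuous
    hcc.continuousOn
  obtain ⟨δ, hδ, hδc⟩ := Metric.uniformContinuousOn_iff.1 huc 1 one_pos
  refine ⟨min (δ / 2) 1, by positivity, min_le_right _ _, fun y z hyz y' hy' => ?_⟩
  obtain ⟨h1, h2, h3, h4⟩ := (mem_boundedSublevel_iff_real hM).1 hyz
  simp only at h1 h2 h3 h4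
  have hyb : ‖y'‖ ≤ r + 1 := by
    have := norm_le_norm_add_norm_sub' y' y
    linarith [hy'.trans (min_le_right _ _)]
  have hd := hδc (y', z) (mem_closedBall_zero_iff.2 (max_le hyb (by simp only; linarith))) (y, z)
    (mem_closedBall_zero_iff.2 (max_le (by simp only; linarith) (by simp only; linarith))) (by
      rw [dist_eq_norm, Prod.mk_sub_mk, sub_self, Prod.norm_mk, norm_zero,
        max_eq_left (norm_nonneg _)]
      linarith [hy'.trans (min_le_left _ _)])
  have hcy : c (y, z) = (g y z).toReal := by
    simp only [hc]
    rw [min_eq_left]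
    exact hyz.1.trans (ENNReal.ofReal_le_ofReal (by linarith))
  rw [Real.dist_eq, hcy] at hd
  have hd' := (abs_lt.1 hd).2
  have hlt : g y' z < ENNReal.ofReal (M + 1) := by
    by_contra hn
    have : c (y', z) = M + 1 := by
      simp only [hc]
      rw [min_eq_right (not_lt.1 hn), ENNReal.toReal_ofReal (by linarith)]
    linarith
  refine ⟨hlt.trans ENNReal.ofReal_lt_top, ?_⟩
  have : c (y', z) = (g y' z).toReal := by
    simp only [hc]
    rw [min_eq_left hlt.le]
  linarith

end Data

/-! ### Consequences of a single BC-ADMM update. -/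

section Iteration

variable {f : Eu n → ℝ≥0∞} {g : Eu m → Eu l → ℝ≥0∞} {A : Eu n →L[ℝ] Eu m} {Z : Set (Eu l)}
  {x₀ : Eu n} {zf : Eu l} {zsol : Eu m → Eu l}

/-- The augmented Lagrangian as a real number, meaningful where `f` and `g` are finite. -/
def lagrangianReal (f : Eu n → ℝ≥0∞) (g : Eu m → Eu l → ℝ≥0∞) (A : Eu n →L[ℝ] Eu m) (β : ℝ)
    (x : Eu n) (y : Eu m) (z : Eu l) (lam : Eu m) : ℝ :=
  (f x).toReal + (g y z).toReal + (β / 2 * ‖A x - y‖ ^ 2 + inner ℝ lam (A x - y))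

theorem lagrangian_add_coe (β : ℝ) (x : Eu n) (y : Eu m) (z : Eu l) (lam : Eu m) (c : ℝ) :
    lagrangian f g A β x y z lam + (c : EReal) = (f x : EReal) + (g y z : EReal)
      + ((β / 2 * ‖A x - y‖ ^ 2 + inner ℝ lam (A x - y) + c : ℝ) : EReal) := by
  rw [lagrangian, add_assoc, ← EReal.coe_add]

theorem lagrangian_add_coe_eq {β : ℝ} {x : Eu n} {y : Eu m} {z : Eu l} {lam : Eu m}
    (hf : f x < ∞) (hg : g y z < ∞) (c : ℝ) :
    lagrangian f g A β x y z lam + (c : EReal)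
      = ((lagrangianReal f g A β x y z lam + c : ℝ) : EReal) := by
  rw [lagrangian_add_coe, coe_add_eq_coe_real hf hg, lagrangianReal]
  congr 1
  ring

theorem finite_of_lagrangian_add_coe_le {β : ℝ} {x : Eu n} {y : Eu m} {z : Eu l} {lam : Eu m}
    {c d : ℝ} (h : lagrangian f g A β x y z lam + (c : EReal) ≤ (d : EReal)) :
    f x < ∞ ∧ g y z < ∞ ∧ lagrangianReal f g A β x y z lam + c ≤ d := by
  rw [lagrangian_add_coe] at h
  obtain ⟨h1, h2, h3⟩ := finite_and_real_le_of_coe_add_le h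
  exact ⟨h1, h2, by rw [lagrangianReal]; linarith⟩

variable {βx βy β : ℝ} {x : ℕ → Eu n} {y : ℕ → Eu m} {z : ℕ → Eu l} {lam : ℕ → Eu m}

theorem IsRun.x_step (hr : IsRun f g A Z x₀ zsol βx βy β x y z lam) {k : ℕ}
    (hf : f (x k) < ∞) (hg : g (y k) (z k) < ∞) :
    f (x (k + 1)) < ∞ ∧ lagrangianReal f g A β (x (k + 1)) (y k) (z k) (lam k)
      + βx / 2 * ‖x (k + 1) - x k‖ ^ 2 ≤ lagrangianReal f g A β (x k) (y k) (z k) (lam k) := by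
  have h := hr.x_descent k
  rw [xObjective, xObjective, lagrangian_add_coe_eq hf hg] at h
  obtain ⟨h1, -, h2⟩ := finite_of_lagrangian_add_coe_le h
  refine ⟨h1, h2.trans_eq ?_⟩
  simp

theorem IsRun.x_stationary (h : Assumptions f g A Z x₀ zf zsol)
    (hr : IsRun f g A Z x₀ zsol βx βy β x y z lam) {k : ℕ}
    (hf : f (x (k + 1)) < ∞) (hg : g (y k) (z k) < ∞) :
    gradient (fun x' => (f x').toReal) (x (k + 1))
      + ContinuousLinearMap.adjoint A (lam k + β • (A (x (k + 1)) - y k))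
      + βx • (x (k + 1) - x k) = 0 := by
  refine gradient_eq_zero_of_isLocalMin_augmented (h.hasGradientAt_f hf) ?_
  filter_upwards [hr.x_local k, (isOpen_dom h.f_cont).mem_nhds hf] with t ht htf
  rw [xObjective, xObjective, lagrangian_add_coe_eq hf hg, lagrangian_add_coe_eq htf hg,
    EReal.coe_le_coe_iff, lagrangianReal, lagrangianReal] at ht
  linarith

theorem IsRun.y_step (hr : IsRun f g A Z x₀ zsol βx βy β x y z lam) {k : ℕ}
    (hf : f (x (k + 1)) < ∞) (hg : g (y k) (z k) < ∞) :
    g (y (k + 1)) (z k) < ∞ ∧ lagrangianReal f g A β (x (k + 1)) (y (k + 1)) (z k) (lam k)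
      + βy / 2 * ‖y (k + 1) - y k‖ ^ 2
        ≤ lagrangianReal f g A β (x (k + 1)) (y k) (z k) (lam k) := by
  have h := hr.y_min k (Set.mem_univ (y k))
  simp only [Set.mem_ofPred_eq] at h
  rw [yObjective, yObjective, lagrangian_add_coe_eq hf hg] at h
  obtain ⟨-, h1, h2⟩ := finite_of_lagrangian_add_coe_le h
  refine ⟨h1, h2.trans_eq ?_⟩
  simp

/-- The optimality condition of the `y`-subproblem contains `lam k + β • (A (x (k + 1)) - y (k +
1))`, which is exactly the updated multiplier. -/
theorem IsRun.lam_succ_eq (h : Assumptions f g A Z x₀ zf zsol)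
    (hr : IsRun f g A Z x₀ zsol βx βy β x y z lam) {k : ℕ}
    (hf : f (x (k + 1)) < ∞) (hg : g (y (k + 1)) (z k) < ∞) :
    lam (k + 1) = gradY g (y (k + 1)) (z k) + βy • (y (k + 1) - y k) := by
  -- The constraint term `A x - t` is written as `B t - w` with `B = -id` and `w = -A x`, the shape
  -- of the general optimality lemma.
  have hmin : IsLocalMin (fun t => (g t (z k)).toReal
      + (β / 2 * ‖(-ContinuousLinearMap.id ℝ (Eu m)) t - (-A (x (k + 1)))‖ ^ 2
        + inner ℝ (lam k) ((-ContinuousLinearMap.id ℝ (Eu m)) t - (-A (x (k + 1)))))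
      + βy / 2 * ‖t - y k‖ ^ 2) (y (k + 1)) := by
    have hopen := (isOpen_dom (h.g_cont.comp (Continuous.prodMk_left (z k)))).mem_nhds hg
    filter_upwards [hopen] with t htg
    have ht := hr.y_min k (Set.mem_univ t)
    simp only [Set.mem_ofPred_eq] at ht
    rw [yObjective, yObjective, lagrangian_add_coe_eq hf hg, lagrangian_add_coe_eq hf htg,
      EReal.coe_le_coe_iff, lagrangianReal, lagrangianReal] at ht
    simp only [neg_apply, ContinuousLinearMap.id_apply, neg_sub_neg]
    linarith
  have h1 := gradient_eq_zero_of_isLocalMin_augmented (h.hasGradientAt_y hg) hmin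
  rw [map_neg, ContinuousLinearMap.adjoint_id] at h1
  simp only [neg_apply, ContinuousLinearMap.id_apply, neg_sub_neg] at h1
  rw [hr.lam_succ k, eq_comm, ← sub_eq_zero]
  rw [← h1]
  abel

theorem IsRun.z_step (hr : IsRun f g A Z x₀ zsol βx βy β x y z lam) {k : ℕ}
    (hf : f (x (k + 1)) < ∞) {w : Eu l} (hw : w ∈ Z) :
    g (y (k + 1)) (z (k + 1)) ≤ g (y (k + 1)) w := by
  rcases eq_or_ne (g (y (k + 1)) w) ∞ with hw' | hw'
  · rw [hw']
    exact le_top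
  have h := hr.z_min k hw
  simp only [Set.mem_ofPred_eq] at h
  rw [← add_zero (lagrangian _ _ _ _ _ _ (z (k + 1)) _), ← add_zero (lagrangian _ _ _ _ _ _ w _),
    ← EReal.coe_zero, lagrangian_add_coe_eq hf hw'.lt_top] at h
  obtain ⟨-, h1, h2⟩ := finite_of_lagrangian_add_coe_le h
  rw [← ENNReal.toReal_le_toReal h1.ne hw']
  rw [lagrangianReal, lagrangianReal] at h2
  linarith

/-! ### Constants chosen before the penalty parameters. -/

/-- Constants, determined by the problem data, that control every run: `T` bounds the energy,
`s` the steps in `y`, `R` the iterates `x` and `z`, and `r` the pairs `(y, z)`; `δ` is a modulus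
of continuity of `g`, and `L`, `Lz` are Lipschitz constants of the gradients and of `zsol`. -/
structure Bounds (f : Eu n → ℝ≥0∞) (g : Eu m → Eu l → ℝ≥0∞) (A : Eu n →L[ℝ] Eu m)
    (Z : Set (Eu l)) (x₀ : Eu n) (zf : Eu l) (zsol : Eu m → Eu l) (T s R r δ L Lz : ℝ) :
    Prop where
  one_le_T : 1 ≤ T
  s_nonneg : 0 ≤ s
  s_sq : s ^ 2 = 2 * T
  δ_pos : 0 < δ
  δ_le : δ ≤ 1
  L_nonneg : 0 ≤ L
  Lz_nonneg : 0 ≤ Lz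
  start : (f x₀).toReal + (g (A x₀) zf).toReal ≤ T - 1
  coercive : ∀ x z, f x < ∞ → g (A x) z < ∞ → (f x).toReal + (g (A x) z).toReal ≤ T + 1 →
    ‖x‖ ≤ R ∧ ‖z‖ ≤ R
  solution : ∀ y z, ‖y‖ ≤ ‖A‖ * R + 1 + s → ‖z‖ ≤ R → z ∈ Z → g y z < ∞ → (g y z).toReal ≤ T →
    (y, z) ∈ boundedSublevel g r T ∧ (y, zsol y) ∈ boundedSublevel g r T ∧ zsol y ∈ Z ∧
      ∀ z' ∈ Z, z' ≠ zsol y → g y (zsol y) < g y z'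
  lipschitz : ∀ y y', zsol y ∈ Z → zsol y' ∈ Z → (y, zsol y) ∈ boundedSublevel g r T →
    (y', zsol y') ∈ boundedSublevel g r T → ‖zsol y - zsol y'‖ ≤ Lz * ‖y - y'‖
  near : ∀ y z, (y, z) ∈ boundedSublevel g r T → ∀ y', ‖y' - y‖ ≤ δ →
    g y' z < ∞ ∧ (g y' z).toReal ≤ (g y z).toReal + 1
  gradY_le : ∀ p ∈ boundedSublevel g (r + 1) (T + 1), ‖gradY g p.1 p.2‖ ≤ L
  gradY_lip : ∀ p ∈ boundedSublevel g (r + 1) (T + 1), ∀ q ∈ boundedSublevel g (r + 1) (T + 1),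
    ‖gradY g p.1 p.2 - gradY g q.1 q.2‖ ≤ L * ‖p - q‖
  gradZ_lip : ∀ p ∈ boundedSublevel g (r + 1) (T + 1), ∀ q ∈ boundedSublevel g (r + 1) (T + 1),
    ‖gradZ g p.1 p.2 - gradZ g q.1 q.2‖ ≤ L * ‖p - q‖

theorem Assumptions.exists_bounds (h : Assumptions f g A Z x₀ zf zsol) :
    ∃ T s R r δ L Lz : ℝ, Bounds f g A Z x₀ zf zsol T s R r δ L Lz := by
  obtain ⟨hf0, hg0⟩ := ENNReal.add_lt_top.1 h.feasible
  -- The extra 1 pays for the loss in `half_sq_add_inner_ge`.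
  set T : ℝ := (f x₀).toReal + (g (A x₀) zf).toReal + 1 with hT
  have hT1 : 1 ≤ T := by
    have := ENNReal.toReal_nonneg (a := f x₀)
    have := ENNReal.toReal_nonneg (a := g (A x₀) zf)
    linarith
  have hT0 : 0 ≤ T := by linarith
  -- Level `T + 1`: replacing `y` by `Ax` may raise `g` by 1.
  obtain ⟨R, hR0, hR⟩ := h.exists_norm_le (T + 1)
  set s : ℝ := √(2 * T) with hs
  have hs0 : 0 ≤ s := Real.sqrt_nonneg _
  -- `‖A‖ * R + 1` bounds `y k`, since `‖A x - y‖ ≤ δ ≤ 1`; `s` is the longest possible `y`-step and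
  -- `R` bounds `z`.
  set r₁ : ℝ := ‖A‖ * R + 1 + s + R with hr₁
  have hAR : 0 ≤ ‖A‖ * R := by positivity
  obtain ⟨r₂, hr₂⟩ := h.minimizer_bound (2 * r₁) ⟨T, hT0⟩
  set r : ℝ := max r₁ r₂ with hr
  obtain ⟨δ, hδ, hδ1, hδg⟩ := exists_near_le_add_one h.g_cont r hT0
  obtain ⟨Lz, hLz⟩ := h.minimizer_lipschitz (2 * r) ⟨T, hT0⟩
  -- The enlargement by 1 in radius and level makes room for the points `(Ax, z)`.
  have hK := isCompact_boundedSublevel h.g_cont (r + 1) (T + 1)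
  have hKfin : ∀ p ∈ boundedSublevel g (r + 1) (T + 1), g p.1 p.2 < ∞ := fun p hp =>
    hp.1.trans_lt ENNReal.ofReal_lt_top
  obtain ⟨L₁, hL₁, hL₁b, hL₁l⟩ := exists_lipschitz_bound_of_contDiffAt hK
    fun p hp => h.contDiffAt_gradY (hKfin p hp)
  obtain ⟨L₂, hL₂, -, hL₂l⟩ := exists_lipschitz_bound_of_contDiffAt hK
    fun p hp => h.contDiffAt_gradZ (hKfin p hp)
  refine ⟨T, s, R, r, δ, max L₁ L₂, Lz, ?_⟩
  exact {
    one_le_T := hT1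
    s_nonneg := hs0
    s_sq := Real.sq_sqrt (by linarith)
    δ_pos := hδ
    δ_le := hδ1
    L_nonneg := le_max_of_le_left hL₁
    Lz_nonneg := Lz.2
    start := by linarith
    coercive := hR
    solution := fun y z hy hz hzZ hfin hle => by
      have h1 : (y, z) ∈ boundedSublevel g r₁ T :=
        (mem_boundedSublevel_iff_real hT0).2 ⟨hfin, hle, by simp only; linarith,
          by simp only; linarith⟩
      have h2 := mem_sublevel_of_mem_boundedSublevel hT0 h1 hzZ
      have h3 := h.minimizer _ _ y z h2
      have h4 := mem_boundedSublevel_of_mem_sublevel hT0 (hr₂ y z h2)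
      exact ⟨boundedSublevel_mono (le_max_left _ _) le_rfl h1,
        boundedSublevel_mono (le_max_right _ _) le_rfl h4, h3⟩
    lipschitz := fun y y' hy hy' hm hm' =>
      hLz.norm_sub_le (mem_sublevel_of_mem_boundedSublevel hT0 hm hy)
        (mem_sublevel_of_mem_boundedSublevel hT0 hm' hy')
    near := hδg
    gradY_le := fun p hp => (hL₁b p hp).trans (le_max_left _ _)
    gradY_lip := fun p hp q hq => (hL₁l p hp q hq).trans (by gcongr; exact le_max_left _ _)
    gradZ_lip := fun p hp q hq => (hL₂l p hp q hq).trans (by gcongr; exact le_max_right _ _) }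

end Iteration

/-! ### The invariant and the Lyapunov descent. -/

section Convergence

variable {f : Eu n → ℝ≥0∞} {g : Eu m → Eu l → ℝ≥0∞} {A : Eu n →L[ℝ] Eu m} {Z : Set (Eu l)}
  {x₀ : Eu n} {zf : Eu l} {zsol : Eu m → Eu l} {T s R r δ L Lz : ℝ}
  {βx βy β : ℝ} {x : ℕ → Eu n} {y : ℕ → Eu m} {z : ℕ → Eu l} {lam : ℕ → Eu m}

/-- The coefficient of the bound on the multiplier steps by the steps in `y`. -/
def stepConst (L Lz βy : ℝ) : ℝ := L * (1 + Lz) + βy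

/-- The requirements on the parameters of BC-ADMM. -/
structure LargeParams (T s δ L Lz βx βy β : ℝ) : Prop where
  one_le_βx : 1 ≤ βx
  one_le_βy : 1 ≤ βy
  β_pos : 0 < β
  lam_sq_le : (L + βy * s) ^ 2 ≤ β
  resid_le : 4 * T ≤ β * δ ^ 2
  step_le : 16 * stepConst L Lz βy ^ 2 ≤ β * βy

/-- The Lyapunov function of BC-ADMM, with the convention `y (-1) = y 0`. -/
def potential (f : Eu n → ℝ≥0∞) (g : Eu m → Eu l → ℝ≥0∞) (A : Eu n →L[ℝ] Eu m) (βy β : ℝ)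
    (x : ℕ → Eu n) (y : ℕ → Eu m) (z : ℕ → Eu l) (lam : ℕ → Eu m) (k : ℕ) : ℝ :=
  lagrangianReal f g A β (x k) (y k) (z k) (lam k) + βy / 4 * ‖y k - y (k - 1)‖ ^ 2

/-- The properties of the `k`-th iterate that BC-ADMM preserves. -/
structure Invariant (f : Eu n → ℝ≥0∞) (g : Eu m → Eu l → ℝ≥0∞) (A : Eu n →L[ℝ] Eu m)
    (Z : Set (Eu l)) (zsol : Eu m → Eu l) (T s R r δ Lz βy β : ℝ)
    (x : ℕ → Eu n) (y : ℕ → Eu m) (z : ℕ → Eu l) (lam : ℕ → Eu m) (k : ℕ) : Prop where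
  f_fin : f (x k) < ∞
  g_fin : g (A (x k)) (z k) < ∞
  x_le : ‖x k‖ ≤ R
  z_le : ‖z k‖ ≤ R
  resid_le : ‖A (x k) - y k‖ ≤ δ
  z_mem : z k ∈ Z
  z_eq : z k = zsol (y k)
  mem : (y k, z k) ∈ boundedSublevel g r T
  mem_prev : (y k, z (k - 1)) ∈ boundedSublevel g r T
  lam_eq : lam k = gradY g (y k) (z (k - 1)) + βy • (y k - y (k - 1))
  energy : potential f g A βy β x y z lam k ≤ T - 1
  z_lip : ‖z k - z (k - 1)‖ ≤ Lz * ‖y k - y (k - 1)‖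
  step : ‖y k - y (k - 1)‖ ≤ s

theorem mem_thickened {p : Eu m × Eu l} (hp : p ∈ boundedSublevel g r T) :
    p ∈ boundedSublevel g (r + 1) (T + 1) :=
  boundedSublevel_mono (by linarith) (by linarith) hp

theorem fin_of_mem {p : Eu m × Eu l} {M : ℝ} (hp : p ∈ boundedSublevel g r M) :
    g p.1 p.2 < ∞ :=
  hp.1.trans_lt ENNReal.ofReal_lt_top

theorem Bounds.mem_of_near (hb : Bounds f g A Z x₀ zf zsol T s R r δ L Lz) {y y' : Eu m}
    {z : Eu l} (hm : (y, z) ∈ boundedSublevel g r T) (hy : ‖y' - y‖ ≤ δ) :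
    (y', z) ∈ boundedSublevel g (r + 1) (T + 1) := by
  have hT := hb.one_le_T
  obtain ⟨h1, h2, h3, h4⟩ := (mem_boundedSublevel_iff_real (by linarith)).1 hm
  obtain ⟨h5, h6⟩ := hb.near y z hm y' hy
  simp only at h2 h3 h4
  refine (mem_boundedSublevel_iff_real (by linarith)).2 ⟨h5, ?_, ?_, ?_⟩
  · simp only
    linarith
  · have := norm_le_norm_add_norm_sub' y' y
    have := hb.δ_le
    simp only
    linarith
  · simp only
    linarith

theorem Bounds.lam_sq_le (hb : Bounds f g A Z x₀ zf zsol T s R r δ L Lz)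
    (hp : LargeParams T s δ L Lz βx βy β) {y v : Eu m} {z : Eu l}
    (hm : (y, z) ∈ boundedSublevel g r T) (hv : ‖v‖ ≤ s) :
    ‖gradY g y z + βy • v‖ ^ 2 ≤ β := by
  have hβy := hp.one_le_βy
  have h1 : ‖gradY g y z‖ ≤ L := hb.gradY_le (y, z) (mem_thickened hm)
  have h2 : ‖βy • v‖ ≤ βy * s := by
    rw [norm_smul, Real.norm_of_nonneg (by linarith)]
    gcongr
  exact (pow_le_pow_left₀ (norm_nonneg _) ((norm_add_le _ _).trans (add_le_add h1 h2)) 2).trans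
    hp.lam_sq_le

theorem Invariant.lam_sq_le (hb : Bounds f g A Z x₀ zf zsol T s R r δ L Lz)
    (hp : LargeParams T s δ L Lz βx βy β) {k : ℕ}
    (hi : Invariant f g A Z zsol T s R r δ Lz βy β x y z lam k) : ‖lam k‖ ^ 2 ≤ β := by
  rw [hi.lam_eq]
  exact hb.lam_sq_le hp hi.mem_prev hi.step

theorem Invariant.potential_ge (hb : Bounds f g A Z x₀ zf zsol T s R r δ L Lz)
    (hp : LargeParams T s δ L Lz βx βy β) {k : ℕ}
    (hi : Invariant f g A Z zsol T s R r δ Lz βy β x y z lam k) :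
    (f (x k)).toReal + (g (y k) (z k)).toReal + β / 4 * ‖A (x k) - y k‖ ^ 2 - 1
      ≤ potential f g A βy β x y z lam k := by
  have h1 := half_sq_add_inner_ge (r := A (x k) - y k) hp.β_pos (hi.lam_sq_le hb hp)
  have h2 : 0 ≤ βy / 4 * ‖y k - y (k - 1)‖ ^ 2 := by
    have := hp.one_le_βy
    positivity
  rw [potential, lagrangianReal]
  linarith

theorem Bounds.invariant_zero (hb : Bounds f g A Z x₀ zf zsol T s R r δ L Lz)
    (h : Assumptions f g A Z x₀ zf zsol) (hr : IsRun f g A Z x₀ zsol βx βy β x y z lam) :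
    Invariant f g A Z zsol T s R r δ Lz βy β x y z lam 0 := by
  obtain ⟨hf0, hg0⟩ := ENNReal.add_lt_top.1 h.feasible
  have hst := hb.start
  have hT := hb.one_le_T
  have hfn := ENNReal.toReal_nonneg (a := f x₀)
  obtain ⟨hxR, hzR⟩ := hb.coercive x₀ zf hf0 hg0 (by linarith)
  have hAx : ‖A x₀‖ ≤ ‖A‖ * R := (A.le_opNorm x₀).trans (by gcongr)
  obtain ⟨-, hm, hZ, hmin⟩ := hb.solution (A x₀) zf (by linarith [hb.s_nonneg]) hzR h.zf_mem hg0
    (by linarith)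
  have hfin : g (A x₀) (zsol (A x₀)) < ∞ := fin_of_mem hm
  have hle : g (A x₀) (zsol (A x₀)) ≤ g (A x₀) zf := by
    rcases eq_or_ne zf (zsol (A x₀)) with he | he
    · rw [← he]
    · exact (hmin zf h.zf_mem he).le
  have hle' := (ENNReal.toReal_le_toReal hfin.ne hg0.ne).2 hle
  have hx0 := hr.x_zero
  have hy0 := hr.y_zero
  have hz0 : z 0 = zsol (A x₀) := by rw [hr.z_zero, hy0]
  obtain ⟨-, hzR'⟩ := hb.coercive x₀ _ hf0 hfin (by linarith)
  refine ⟨?_, ?_, ?_, ?_, ?_, ?_, ?_, ?_, ?_, ?_, ?_, ?_, ?_⟩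
  · rwa [hx0]
  · rwa [hx0, hz0]
  · rwa [hx0]
  · rwa [hz0]
  · rw [hx0, hy0, sub_self, norm_zero]
    exact hb.δ_pos.le
  · rwa [hz0]
  · rw [hz0, hy0]
  · rwa [hz0, hy0]
  · rwa [Nat.zero_sub, hz0, hy0]
  -- With truncated subtraction `0 - 1 = 0`, the prescribed initial multiplier already has the form
  -- produced by a `y`-update.
  · rw [Nat.zero_sub, hr.lam_zero, sub_self, smul_zero, add_zero]
  · rw [potential, lagrangianReal, hx0, hy0, hz0]
    simp only [sub_self, norm_zero, inner_zero_right]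
    linarith
  · simp
  · simpa using hb.s_nonneg

theorem Invariant.lam_step_le (hb : Bounds f g A Z x₀ zf zsol T s R r δ L Lz)
    (hp : LargeParams T s δ L Lz βx βy β) {k : ℕ}
    (hi : Invariant f g A Z zsol T s R r δ Lz βy β x y z lam k)
    (hm : (y (k + 1), z k) ∈ boundedSublevel g r T)
    (hlam : lam (k + 1) = gradY g (y (k + 1)) (z k) + βy • (y (k + 1) - y k)) :
    ‖lam (k + 1) - lam k‖ ≤
      stepConst L Lz βy * (‖y (k + 1) - y k‖ + ‖y k - y (k - 1)‖) := by
  have hβy := hp.one_le_βy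
  have hL := hb.L_nonneg
  have hLz := hb.Lz_nonneg
  set d' := ‖y (k + 1) - y k‖ with hd'
  set d := ‖y k - y (k - 1)‖ with hd
  have hd'0 : 0 ≤ d' := norm_nonneg _
  have hd0 : 0 ≤ d := norm_nonneg _
  have h1 : ‖gradY g (y (k + 1)) (z k) - gradY g (y k) (z (k - 1))‖ ≤ L * (d' + Lz * d) := by
    refine (hb.gradY_lip _ (mem_thickened hm) _ (mem_thickened hi.mem_prev)).trans ?_
    gcongr
    rw [Prod.mk_sub_mk, Prod.norm_mk]
    exact max_le (by linarith [mul_nonneg hLz hd0]) (by linarith [hi.z_lip])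
  have h2 : lam (k + 1) - lam k = (gradY g (y (k + 1)) (z k) - gradY g (y k) (z (k - 1)))
      + (βy • (y (k + 1) - y k) - βy • (y k - y (k - 1))) := by
    rw [hlam, hi.lam_eq]
    abel
  have h3 : ‖βy • (y (k + 1) - y k) - βy • (y k - y (k - 1))‖ ≤ βy * d' + βy * d := by
    refine (norm_sub_le _ _).trans ?_
    rw [norm_smul, norm_smul, Real.norm_of_nonneg (by linarith)]
  rw [h2]
  refine (norm_add_le _ _).trans ((add_le_add h1 h3).trans ?_)
  rw [stepConst]
  nlinarith [mul_nonneg (mul_nonneg hL hLz) hd'0, mul_nonneg hL hd0]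

theorem IsRun.mul_resid (hr : IsRun f g A Z x₀ zsol βx βy β x y z lam) (k : ℕ) :
    lam (k + 1) - lam k = β • (A (x (k + 1)) - y (k + 1)) := by
  rw [hr.lam_succ k, add_sub_cancel_left]

/-- The order of the estimates avoids circularity: the old multiplier bound controls the energy
after the `y`-update, hence the new `y` and `z`; the new multiplier is then explicit, and only
afterwards are descent, the residual and the bounds on `x` and `z` obtained. -/
theorem Invariant.succ (h : Assumptions f g A Z x₀ zf zsol)
    (hb : Bounds f g A Z x₀ zf zsol T s R r δ L Lz) (hp : LargeParams T s δ L Lz βx βy β)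
    (hr : IsRun f g A Z x₀ zsol βx βy β x y z lam) {k : ℕ}
    (hi : Invariant f g A Z zsol T s R r δ Lz βy β x y z lam k) :
    Invariant f g A Z zsol T s R r δ Lz βy β x y z lam (k + 1) ∧
      ‖lam (k + 1) - lam k‖ ≤
        stepConst L Lz βy * (‖y (k + 1) - y k‖ + ‖y k - y (k - 1)‖) ∧
      potential f g A βy β x y z lam (k + 1) + 1 / 8 * (‖x (k + 1) - x k‖ ^ 2
        + ‖y (k + 1) - y k‖ ^ 2 + ‖y k - y (k - 1)‖ ^ 2)
          ≤ potential f g A βy β x y z lam k := by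
  have hT := hb.one_le_T
  have hβ := hp.β_pos
  have hβx := hp.one_le_βx
  have hβy := hp.one_le_βy
  obtain ⟨hf', hxs⟩ := hr.x_step hi.f_fin (fin_of_mem hi.mem)
  obtain ⟨hgy, hys⟩ := hr.y_step hf' (fin_of_mem hi.mem)
  have hfn := ENNReal.toReal_nonneg (a := f (x (k + 1)))
  have hgn := ENNReal.toReal_nonneg (a := g (y (k + 1)) (z k))
  set a := ‖x (k + 1) - x k‖ with ha
  set d' := ‖y (k + 1) - y k‖ with hd'
  set d := ‖y k - y (k - 1)‖ with hd
  have henergy : lagrangianReal f g A β (x k) (y k) (z k) (lam k) + βy / 4 * d ^ 2 ≤ T - 1 :=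
    hi.energy
  have hlow := half_sq_add_inner_ge (r := A (x (k + 1)) - y (k + 1)) hβ (hi.lam_sq_le hb hp)
  have hq1 : 0 ≤ β / 4 * ‖A (x (k + 1)) - y (k + 1)‖ ^ 2 := by positivity
  have hq2 : 0 ≤ βy / 4 * d ^ 2 := by positivity
  have hq3 : 0 ≤ βx / 2 * a ^ 2 := by positivity
  have hq4 : 1 / 2 * d' ^ 2 ≤ βy / 2 * d' ^ 2 := by gcongr
  have hq5 : 0 ≤ d' ^ 2 := by positivity
  have hsum : (f (x (k + 1))).toReal + (g (y (k + 1)) (z k)).toReal + βy / 2 * d' ^ 2 ≤ T := by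
    rw [lagrangianReal] at hys
    linarith
  -- From `βy ≥ 1` and `s ^ 2 = 2 * T`; thus `s` is independent of the penalties.
  have hd's : d' ≤ s := by
    refine le_of_sq_le_sq ?_ hb.s_nonneg
    rw [hb.s_sq]
    linarith
  have hyk : ‖y k‖ ≤ ‖A‖ * R + 1 := by
    have h1 := norm_le_norm_add_norm_sub (A (x k)) (y k)
    have h2 : ‖A (x k)‖ ≤ ‖A‖ * R := (A.le_opNorm _).trans (by gcongr; exact hi.x_le)
    have := hi.resid_le
    have := hb.δ_le
    linarith
  have hyk' : ‖y (k + 1)‖ ≤ ‖A‖ * R + 1 + s := by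
    have h1 := norm_le_norm_add_norm_sub' (y (k + 1)) (y k)
    linarith
  obtain ⟨hmp, hms, hZs, hmin⟩ := hb.solution _ _ hyk' hi.z_le hi.z_mem hgy (by linarith)
  -- Any other point of `Z` would have a strictly larger value than `zsol (y (k + 1))`,
  -- contradicting the `z`-update.
  have hz' : z (k + 1) = zsol (y (k + 1)) := by
    by_contra hne
    exact absurd (hr.z_step hf' hZs) (not_le.2 (hmin _ (hr.z_mem k) hne))
  have hm' : (y (k + 1), z (k + 1)) ∈ boundedSublevel g r T := by rwa [hz']
  have hgz : (g (y (k + 1)) (z (k + 1))).toReal ≤ (g (y (k + 1)) (z k)).toReal :=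
    (ENNReal.toReal_le_toReal (fin_of_mem hm').ne hgy.ne).2 (hr.z_step hf' hi.z_mem)
  have hlam := hr.lam_succ_eq h hf' hgy
  have hzl : ‖z (k + 1) - z k‖ ≤ Lz * d' := by
    have h1 := hi.mem
    have h2 := hi.z_mem
    rw [hi.z_eq] at h1 h2
    rw [hz', hi.z_eq]
    exact hb.lipschitz _ _ hZs h2 hms h1
  have hstep := hi.lam_step_le hb hp hmp hlam
  rw [← hd', ← hd] at hstep
  have hinner : β * inner ℝ (lam (k + 1) - lam k) (A (x (k + 1)) - y (k + 1))
      = ‖lam (k + 1) - lam k‖ ^ 2 := by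
    rw [← real_inner_smul_right, ← hr.mul_resid k, real_inner_self_eq_norm_sq]
  have hdual : inner ℝ (lam (k + 1) - lam k) (A (x (k + 1)) - y (k + 1))
      ≤ βy / 8 * (d' ^ 2 + d ^ 2) := by
    refine le_of_mul_le_mul_left ?_ hβ
    rw [hinner]
    have hd0 : 0 ≤ d := norm_nonneg _
    have hd'0 : 0 ≤ d' := norm_nonneg _
    calc ‖lam (k + 1) - lam k‖ ^ 2 ≤ (stepConst L Lz βy * (d' + d)) ^ 2 := by gcongr
      _ = stepConst L Lz βy ^ 2 * (d' + d) ^ 2 := by ring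
      _ ≤ (β * βy / 16) * (2 * (d' ^ 2 + d ^ 2)) := by
        have := hp.step_le
        gcongr
        · linarith
        · nlinarith [sq_nonneg (d' - d)]
      _ = β * (βy / 8 * (d' ^ 2 + d ^ 2)) := by ring
  -- Budget in units of `βy`: for `d' ^ 2`, gain 1/2, minus 1/8 for the dual step and 1/4 for the
  -- new potential; for `d ^ 2`, 1/4 from the old potential minus 1/8. Both leave 1/8.
  have hdescent : potential f g A βy β x y z lam (k + 1) + 1 / 8 * (a ^ 2 + d' ^ 2 + d ^ 2)
      ≤ potential f g A βy β x y z lam k := by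
    have e1 : potential f g A βy β x y z lam k
      = lagrangianReal f g A β (x k) (y k) (z k) (lam k) + βy / 4 * d ^ 2 := rfl
    have e2 : potential f g A βy β x y z lam (k + 1)
      = lagrangianReal f g A β (x (k + 1)) (y (k + 1)) (z (k + 1)) (lam (k + 1))
        + βy / 4 * d' ^ 2 := rfl
    rw [inner_sub_left] at hdual
    rw [e1, e2]
    have hq6 : 1 / 8 * a ^ 2 ≤ βx / 2 * a ^ 2 := by gcongr; linarith
    have hq7 : 1 / 8 * d ^ 2 ≤ βy / 8 * d ^ 2 := by gcongr
    have hq8 : 1 / 8 * d' ^ 2 ≤ βy / 8 * d' ^ 2 := by gcongr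
    rw [lagrangianReal] at hys ⊢
    linarith
  have hpot' : potential f g A βy β x y z lam (k + 1) ≤ T - 1 := by
    have : 0 ≤ 1 / 8 * (a ^ 2 + d' ^ 2 + d ^ 2) := by positivity
    linarith [hi.energy]
  have hlam' : ‖lam (k + 1)‖ ^ 2 ≤ β := by
    rw [hlam]
    exact hb.lam_sq_le hp hmp hd's
  have hlow' := half_sq_add_inner_ge (r := A (x (k + 1)) - y (k + 1)) hβ hlam'
  have hgn' := ENNReal.toReal_nonneg (a := g (y (k + 1)) (z (k + 1)))
  have hsum' : (f (x (k + 1))).toReal + (g (y (k + 1)) (z (k + 1))).toReal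
      + β / 4 * ‖A (x (k + 1)) - y (k + 1)‖ ^ 2 ≤ T := by
    have : 0 ≤ βy / 4 * d' ^ 2 := by positivity
    have e2 : potential f g A βy β x y z lam (k + 1)
      = lagrangianReal f g A β (x (k + 1)) (y (k + 1)) (z (k + 1)) (lam (k + 1))
        + βy / 4 * d' ^ 2 := rfl
    rw [e2, lagrangianReal] at hpot'
    linarith
  have hres : ‖A (x (k + 1)) - y (k + 1)‖ ≤ δ := by
    refine le_of_sq_le_sq ?_ hb.δ_pos.le
    refine le_of_mul_le_mul_left ?_ hβ
    linarith [hp.resid_le]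
  obtain ⟨hgA, hgA'⟩ := hb.near _ _ hm' _ hres
  obtain ⟨hxR, hzR⟩ := hb.coercive _ _ hf' hgA (by linarith)
  exact ⟨⟨hf', hgA, hxR, hzR, hres, hr.z_mem k, hz', hm', hmp, hlam, hpot', hzl, hd's⟩, hstep,
    hdescent⟩

theorem Bounds.invariant (hb : Bounds f g A Z x₀ zf zsol T s R r δ L Lz)
    (h : Assumptions f g A Z x₀ zf zsol) (hp : LargeParams T s δ L Lz βx βy β)
    (hr : IsRun f g A Z x₀ zsol βx βy β x y z lam) (k : ℕ) :
    Invariant f g A Z zsol T s R r δ Lz βy β x y z lam k := by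
  induction k with
  | zero => exact hb.invariant_zero h hr
  | succ k ih => exact (ih.succ h hb hp hr).1

/-! ### Stationarity residual and complexity. -/

/-- The factor between the length of an iteration and the stationarity residual. -/
def residualConst (a L Lz βx βy β : ℝ) : ℝ :=
  a * (L * (stepConst L Lz βy / β + Lz) + βy + β) + βx + L * (stepConst L Lz βy / β)

theorem Bounds.isEpsStationary (hb : Bounds f g A Z x₀ zf zsol T s R r δ L Lz)
    (h : Assumptions f g A Z x₀ zf zsol) (hp : LargeParams T s δ L Lz βx βy β)
    (hr : IsRun f g A Z x₀ zsol βx βy β x y z lam) (k : ℕ) :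
    IsEpsStationary f g A Z (residualConst ‖A‖ L Lz βx βy β
      * (‖x (k + 1) - x k‖ + ‖y (k + 1) - y k‖ + ‖y k - y (k - 1)‖)) (x (k + 1)) (z (k + 1)) := by
  have hi := hb.invariant h hp hr k
  obtain ⟨hi', hstep, -⟩ := hi.succ h hb hp hr
  have hβ := hp.β_pos
  have hβx := hp.one_le_βx
  have hβy := hp.one_le_βy
  have hL := hb.L_nonneg
  have hLz := hb.Lz_nonneg
  have hA := norm_nonneg A
  have hB : 0 ≤ stepConst L Lz βy := by
    rw [stepConst]
    positivity
  set b := stepConst L Lz βy / β with hbdef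
  have hb0 : 0 ≤ b := by positivity
  set a := ‖x (k + 1) - x k‖ with ha
  set d' := ‖y (k + 1) - y k‖ with hd'
  set d := ‖y k - y (k - 1)‖ with hd
  have ha0 : 0 ≤ a := norm_nonneg _
  have hd0 : 0 ≤ d := norm_nonneg _
  have hd'0 : 0 ≤ d' := norm_nonneg _
  have hzl : ‖z (k + 1) - z k‖ ≤ Lz * d' := hi'.z_lip
  have hmp : (y (k + 1), z k) ∈ boundedSublevel g r T := hi'.mem_prev
  have hlam : lam (k + 1) = gradY g (y (k + 1)) (z k) + βy • (y (k + 1) - y k) := hi'.lam_eq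
  have hres : ‖A (x (k + 1)) - y (k + 1)‖ ≤ b * (d' + d) := by
    refine le_of_mul_le_mul_left ?_ hβ
    rw [hr.mul_resid k, norm_smul, Real.norm_of_nonneg hβ.le] at hstep
    refine hstep.trans_eq ?_
    rw [hbdef]
    field_simp
  have hnear := hb.mem_of_near hi'.mem hi'.resid_le
  refine ⟨hi'.z_mem, ENNReal.add_lt_top.2 ⟨hi'.f_fin, hi'.g_fin⟩, ?_, ?_⟩
  · have hfoc := hr.x_stationary h hi'.f_fin (fin_of_mem hi.mem)
    -- The `x`-update sees the old `y` and `lam`; in terms of the new ones the discrepancy is only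
    -- `β` times the `y`-step.
    have hmul : lam k + β • (A (x (k + 1)) - y k) = lam (k + 1) + β • (y (k + 1) - y k) := by
      rw [hr.lam_succ k, add_assoc, ← smul_add, sub_add_sub_cancel]
    have hG : ‖gradY g (A (x (k + 1))) (z (k + 1)) - gradY g (y (k + 1)) (z k)‖
        ≤ L * (b * (d' + d) + Lz * d') := by
      refine (hb.gradY_lip _ hnear _ (mem_thickened hmp)).trans ?_
      gcongr
      rw [Prod.mk_sub_mk, Prod.norm_mk]
      have := mul_nonneg hLz hd'0
      have := mul_nonneg hb0 (add_nonneg hd'0 hd0)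
      exact max_le (by linarith) (by linarith)
    have hid : gradient (fun x' => (f x').toReal) (x (k + 1))
        + ContinuousLinearMap.adjoint A (gradY g (A (x (k + 1))) (z (k + 1)))
        = ContinuousLinearMap.adjoint A
          ((gradY g (A (x (k + 1))) (z (k + 1)) - gradY g (y (k + 1)) (z k))
            - (βy + β) • (y (k + 1) - y k)) - βx • (x (k + 1) - x k) := by
      rw [hmul, hlam] at hfoc
      rw [← sub_eq_zero, ← hfoc]
      simp only [map_add, map_sub, map_smul, add_smul]
      abel
    rw [hid]
    have hlin : ‖(gradY g (A (x (k + 1))) (z (k + 1)) - gradY g (y (k + 1)) (z k))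
        - (βy + β) • (y (k + 1) - y k)‖ ≤ L * (b * (d' + d) + Lz * d') + (βy + β) * d' := by
      refine (norm_sub_le _ _).trans (add_le_add hG ?_)
      rw [norm_smul, Real.norm_of_nonneg (by linarith)]
    refine (norm_sub_le _ _).trans ?_
    rw [norm_smul, Real.norm_of_nonneg (by linarith : 0 ≤ βx), ← ha]
    have hadj : ‖ContinuousLinearMap.adjoint A‖ = ‖A‖ := LinearIsometryEquiv.norm_map _ _
    have h1 : ‖ContinuousLinearMap.adjoint A
          ((gradY g (A (x (k + 1))) (z (k + 1)) - gradY g (y (k + 1)) (z k))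
            - (βy + β) • (y (k + 1) - y k))‖
        ≤ ‖A‖ * (L * (b * (d' + d) + Lz * d') + (βy + β) * d') := by
      refine (ContinuousLinearMap.le_opNorm _ _).trans ?_
      rw [hadj]
      gcongr
    have h2 : L * (b * (d' + d) + Lz * d') + (βy + β) * d'
        ≤ (L * (b + Lz) + βy + β) * (a + d' + d) := by
      have e : (L * (b + Lz) + βy + β) * (a + d' + d)
        = L * (b * (d' + d) + Lz * d') + (βy + β) * d'
          + (L * b * a + L * Lz * (a + d) + (βy + β) * (a + d)) := by ring
      rw [e]
      exact le_add_of_nonneg_right (by positivity)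
    have h3 := mul_le_mul_of_nonneg_left h2 hA
    have h4 : 0 ≤ βx * (d' + d) + L * b * (a + d' + d) := by positivity
    rw [residualConst, ← hbdef]
    linarith
  -- Optimality in `z` holds at `y (k + 1)`, not at `A (x (k + 1))`; the residual `Ax - y` accounts
  -- for the distance to the normal cone.
  · have hN : -gradZ g (y (k + 1)) (z (k + 1)) ∈ normalCone Z (z (k + 1)) := by
      refine regularNormalCone_subset_normalCone _ _ (neg_gradient_mem_regularNormalCone
        hi'.z_mem (h.hasGradientAt_z (fin_of_mem hi'.mem)) ?_)
      have hopen : {w | g (y (k + 1)) w < ∞} ∈ 𝓝 (z (k + 1)) :=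
        (isOpen_dom (h.g_cont.comp (Continuous.prodMk_right (y (k + 1))))).mem_nhds
          (fin_of_mem hi'.mem)
      filter_upwards [self_mem_nhdsWithin, mem_nhdsWithin_of_mem_nhds hopen] with w hw hwf
      exact (ENNReal.toReal_le_toReal (fin_of_mem hi'.mem).ne hwf.ne).2
        (hr.z_step hi'.f_fin hw)
    refine (Metric.infDist_le_dist_of_mem hN).trans ?_
    rw [dist_neg_neg, dist_eq_norm]
    have h1 : ‖gradZ g (A (x (k + 1))) (z (k + 1)) - gradZ g (y (k + 1)) (z (k + 1))‖
        ≤ L * (b * (d' + d)) := by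
      refine (hb.gradZ_lip _ hnear _ (mem_thickened hi'.mem)).trans ?_
      gcongr
      rw [Prod.mk_sub_mk, Prod.norm_mk, sub_self, norm_zero, max_eq_left (norm_nonneg _)]
      exact hres
    refine h1.trans ?_
    have e : residualConst ‖A‖ L Lz βx βy β * (a + d' + d) = L * (b * (d' + d))
        + (L * b * a + (‖A‖ * (L * (b + Lz) + βy + β) + βx) * (a + d' + d)) := by
      rw [residualConst, ← hbdef]
      ring
    rw [e]
    exact le_add_of_nonneg_right (by positivity)

theorem Bounds.exists_short_step (hb : Bounds f g A Z x₀ zf zsol T s R r δ L Lz)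
    (h : Assumptions f g A Z x₀ zf zsol) (hp : LargeParams T s δ L Lz βx βy β)
    (hr : IsRun f g A Z x₀ zsol βx βy β x y z lam) {N : ℕ} (hN : 0 < N) :
    ∃ k < N, (‖x (k + 1) - x k‖ + ‖y (k + 1) - y k‖ + ‖y k - y (k - 1)‖) ^ 2 ≤ 24 * T / N := by
  have hi := hb.invariant h hp hr
  set Φ := potential f g A βy β x y z lam with hΦ
  have hsum : ∑ k ∈ Finset.range N, 1 / 8 * (‖x (k + 1) - x k‖ ^ 2 + ‖y (k + 1) - y k‖ ^ 2
      + ‖y k - y (k - 1)‖ ^ 2) ≤ ∑ _k ∈ Finset.range N, T / N := by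
    calc _ ≤ ∑ k ∈ Finset.range N, (Φ k - Φ (k + 1)) := by
          refine Finset.sum_le_sum fun k _ => ?_
          have := ((hi k).succ h hb hp hr).2.2
          linarith
      _ = Φ 0 - Φ N := Finset.sum_range_sub' Φ N
      -- The potential starts at most at `T - 1` and never falls below `-1`.
      _ ≤ T := by
          have h1 := (hi N).potential_ge hb hp
          have h2 := (hi 0).energy
          have h3 := ENNReal.toReal_nonneg (a := f (x N))
          have h4 := ENNReal.toReal_nonneg (a := g (y N) (z N))
          have h5 : 0 ≤ β / 4 * ‖A (x N) - y N‖ ^ 2 := by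
            have := hp.β_pos
            positivity
          linarith
      _ = ∑ _k ∈ Finset.range N, T / N := by
          rw [Finset.sum_const, Finset.card_range, nsmul_eq_mul]
          field_simp
  obtain ⟨k, hk, hle⟩ := Finset.exists_le_of_sum_le (Finset.nonempty_range_iff.2 hN.ne') hsum
  refine ⟨k, Finset.mem_range.1 hk, ?_⟩
  -- `24 = 3 * 8`: 3 from the square of a sum of three terms, 8 from the descent coefficient `1 /
  -- 8`.
  have e : 24 * T / N = 24 * (T / N) := by ring
  rw [e]
  nlinarith [sq_nonneg (‖x (k + 1) - x k‖ - ‖y (k + 1) - y k‖),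
    sq_nonneg (‖x (k + 1) - x k‖ - ‖y k - y (k - 1)‖),
    sq_nonneg (‖y (k + 1) - y k‖ - ‖y k - y (k - 1)‖)]

theorem IsEpsStationary.mono {ε ε' : ℝ} {x : Eu n} {z : Eu l} (hε : ε ≤ ε')
    (h : IsEpsStationary f g A Z ε x z) : IsEpsStationary f g A Z ε' x z :=
  ⟨h.mem, h.finite, h.grad_x.trans hε, h.grad_z.trans hε⟩

theorem Bounds.exists_isEpsStationary (hb : Bounds f g A Z x₀ zf zsol T s R r δ L Lz)
    (h : Assumptions f g A Z x₀ zf zsol) (hp : LargeParams T s δ L Lz βx βy β)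
    (hr : IsRun f g A Z x₀ zsol βx βy β x y z lam) {ε : ℝ} (hε : 0 < ε) (hε1 : ε ≤ 1) :
    ∃ k : ℕ, (k : ℝ) ≤ (residualConst ‖A‖ L Lz βx βy β ^ 2 * (24 * T) + 2) * ε⁻¹ ^ 2 ∧
      IsEpsStationary f g A Z ε (x k) (z k) := by
  set c := residualConst ‖A‖ L Lz βx βy β with hc
  have hT := hb.one_le_T
  set N : ℕ := ⌈c ^ 2 * (24 * T) * ε⁻¹ ^ 2⌉₊ + 1 with hNdef
  have hN1 : c ^ 2 * (24 * T) * ε⁻¹ ^ 2 ≤ N := by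
    rw [hNdef]
    push_cast
    linarith [Nat.le_ceil (c ^ 2 * (24 * T) * ε⁻¹ ^ 2)]
  have hN2 : (N : ℝ) ≤ c ^ 2 * (24 * T) * ε⁻¹ ^ 2 + 2 := by
    rw [hNdef]
    push_cast
    linarith [Nat.ceil_lt_add_one (show 0 ≤ c ^ 2 * (24 * T) * ε⁻¹ ^ 2 by positivity)]
  have hN0 : 0 < N := Nat.succ_pos _
  obtain ⟨k, hk, hle⟩ := hb.exists_short_step h hp hr hN0
  refine ⟨k + 1, ?_, (hb.isEpsStationary h hp hr k).mono ?_⟩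
  · have h1 : ((k + 1 : ℕ) : ℝ) ≤ N := by exact_mod_cast hk
    -- Here `ε ≤ 1` lets the additive 2 from rounding be absorbed into the constant.
    have h2 : 1 ≤ ε⁻¹ ^ 2 := one_le_pow₀ ((one_le_inv₀ hε).2 hε1)
    linarith
  · refine le_of_sq_le_sq ?_ hε.le
    have hNR : (0 : ℝ) < N := by exact_mod_cast hN0
    rw [mul_pow]
    refine (mul_le_mul_of_nonneg_left hle (sq_nonneg c)).trans ?_
    rw [← mul_div_assoc, div_le_iff₀ hNR]
    have h3 : ε ^ 2 * ε⁻¹ ^ 2 = 1 := by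
      rw [← mul_pow, mul_inv_cancel₀ hε.ne', one_pow]
    calc c ^ 2 * (24 * T) = ε ^ 2 * (c ^ 2 * (24 * T) * ε⁻¹ ^ 2) := by
          linear_combination (-(c ^ 2 * (24 * T))) * h3
      _ ≤ ε ^ 2 * N := by gcongr

/-- With `βy` fixed, each remaining requirement is a lower bound on `β` alone; the threshold adds
the three. For the last one, `βy ≥ 1` allows dropping `βy` from the product. -/
theorem Bounds.exists_largeParams (hb : Bounds f g A Z x₀ zf zsol T s R r δ L Lz) {βy : ℝ}
    (hβy : 1 ≤ βy) :
    ∃ β₀ > (0 : ℝ), ∀ βx ≥ 1, ∀ β ≥ β₀, LargeParams T s δ L Lz βx βy β := by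
  have hT := hb.one_le_T
  have hδ := hb.δ_pos
  have hδ2 : 0 < 4 * T / δ ^ 2 := by positivity
  refine ⟨(L + βy * s) ^ 2 + 4 * T / δ ^ 2 + 16 * stepConst L Lz βy ^ 2, by positivity,
    fun βx hβx β hβ => ?_⟩
  have h1 : 0 ≤ (L + βy * s) ^ 2 := sq_nonneg _
  have h2 : 0 ≤ 16 * stepConst L Lz βy ^ 2 := by positivity
  have hβ0 : 0 < β := by linarith
  refine ⟨hβx, hβy, hβ0, by linarith, ?_, ?_⟩
  · rw [← div_le_iff₀ (by positivity)]
    linarith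
  · nlinarith

end Convergence

end BCADMM

end

theorem mainTheorem2 {n m l : ℕ}
    (f : BCADMM.Eu n → ℝ≥0∞) (g : BCADMM.Eu m → BCADMM.Eu l → ℝ≥0∞)
    (A : BCADMM.Eu n →L[ℝ] BCADMM.Eu m) (Z : Set (BCADMM.Eu l))
    (x₀ : BCADMM.Eu n) (zf : BCADMM.Eu l) (zsol : BCADMM.Eu m → BCADMM.Eu l)
    (h : BCADMM.Assumptions f g A Z x₀ zf zsol) :
    ∃ βx₀ > (0 : ℝ), ∃ βy₀ > (0 : ℝ), ∀ βy ≥ βy₀, ∃ β₀ > (0 : ℝ), ∀ βx ≥ βx₀, ∀ β ≥ β₀,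
      (∀ x y z lam, BCADMM.IsRun f g A Z x₀ zsol βx βy β x y z lam →
        ∀ k : ℕ, f (x k) + g (A (x k)) (z k) < ∞) ∧
      ∃ C : ℝ, ∀ x y z lam, BCADMM.IsRun f g A Z x₀ zsol βx βy β x y z lam →
        ∀ ε : ℝ, 0 < ε → ε ≤ 1 →
          ∃ k : ℕ, (k : ℝ) ≤ C * ε⁻¹ ^ 2 ∧ BCADMM.IsEpsStationary f g A Z ε (x k) (z k) := by
  -- All constants are fixed before any parameter or run is introduced, which makes the final `C`
  -- uniform over runs and over `ε`.
  obtain ⟨T, s, R, r, δ, L, Lz, hb⟩ := h.exists_bounds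
  refine ⟨1, one_pos, 1, one_pos, fun βy hβy => ?_⟩
  obtain ⟨β₀, hβ₀, hlarge⟩ := hb.exists_largeParams hβy
  refine ⟨β₀, hβ₀, fun βx hβx β hβ => ⟨fun x y z lam hr k => ?_, _, fun x y z lam hr ε hε hε1 =>
    hb.exists_isEpsStationary h (hlarge βx hβx β hβ) hr hε hε1⟩⟩
  have hi := hb.invariant h (hlarge βx hβx β hβ) hr k
  exact ENNReal.add_lt_top.2 ⟨hi.f_fin, hi.g_fin⟩
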